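/- Let $A$ be a von Neumann algebra on a complex Hilbert space $H$ and let $a\in A$ be self-adjoint. **Contexts and states.** A context is an abelian von Neumann subalgebra $C\subseteq A$ containing the unit of $A$; let $\mathcal C$ be the set of contexts ordered by inclusion, and $\mathcal C_\downarrow$ the same set with the down-closed sets as open sets. Let $\Sigma_C$ be the Gelfand spectrum of $C$ (its characters, with the weak-* topology) and write $\langle\lambda,b\rangle=\lambda(b)$ for $\lambda\in\Sigma_C$, $b\in C$. Let $\Sigma_\downarrow=\coprod_{C\in\mathcal C}\Sigma_C$, where $U\subseteq\Sigma_\downarrow$ is open iff $U\cap\Sigma_C$ is open in $\Sigma_C$ for every $C$, and $(C,\lambda)\in U$, $D\subseteq C$ imply $(D,\lambda|_D)\in U$. **Daseinisation.** For self-adjoint $b$ and Borel $\Delta\subseteq\mathbb R$ let $\chi_\Delta(b)$ be the spectral projection, and let $b\le_s c$ (the spectral order) mean $\chi_{(-\infty,x]}(b)\ge\chi_{(-\infty,x]}(c)$ for all $x\in\mathbb R$. For a projection $p\in A$ and $C\in\mathcal C$ put $$\delta^o(p)_C=\bigwedge\{q\in\mathrm{Proj}(C)\mid q\ge p\},\quad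 \delta^o(a)_C=\bigwedge\{b\in C_{sa}\mid b\ge_s a\},\quad \delta^i(a)_C=\bigvee\{b\in C_{sa}\mid b\le_s a\},$$ with meets and joins taken in $\mathrm{Proj}(C)$, respectively in the self-adjoint part $C_{sa}$ of $C$, for the usual operator order. Put $$[a\in\Delta]=\{(C,\lambda)\in\Sigma_\downarrow\mid\langle\lambda,\delta^o(\chi_\Delta(a))_C\rangle=1\},\qquad [a<r]=[a\in(-\infty,r)],\qquad [a>s]=[a\in(s,\infty)].$$ **Values.** Let $\mathbb R_u$ and $\mathbb R_l$ be the set $[-\infty,\infty]$ with the topology generated by the sets $[-\infty,y)$, respectively $(y,\infty]$. Define $$\delta(a):\Sigma_\downarrow\to\mathcal C_\downarrow\times\mathbb R_u\times\mathbb R_l,\qquad \delta(a)(C,\lambda)=(C,\langle\lambda,\delta^i(a)_C\rangle,\langle\lambda,\delta^o(a)_C\rangle),$$ and for real $r,s$ and $\epsilon>0$ the open sets $$\hat\Delta=\mathcal C\times[-\infty,r)\times(s,\infty],\qquad \hat\Delta+\epsilon=\mathcal C\times[-\infty,r+\epsilon)\times(s-\epsilon,\infty].$$ **Theorem 3.16.**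 The meets and joins defining $\delta^i(a)_C$, $\delta^o(a)_C$ and $\delta^o(\chi_\Delta(a))_C$ ($C\in\mathcal C$, $\Delta\subseteq\mathbb R$ Borel) exist, the map $\delta(a)$ is continuous, and for all $r,s\in\mathbb R$ and $\epsilon>0$, $$\delta(a)^{-1}(\hat\Delta)\subseteq[a<r]\cap[a>s]\subseteq\delta(a)^{-1}(\hat\Delta+\epsilon).$$ -/

import Mathlib

noncomputable section

namespace ContravariantModel

open Set TopologicalSpace

/-! ### Spectral projections and the spectral order -/

section Spectral

variable {H : Type*} [NormedAddCommGroup H] [InnerProductSpace ℂ H] [CompleteSpace H]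

/-- For a closed set `K`, the vectors whose spectral measure with respect to the self-adjoint
operator `a` is concentrated on `K`: those annihilated by `f(a)` (continuous functional calculus)
for every continuous `f : ℝ → ℝ` that vanishes on `K`. -/
def spectrallySupported (a : H →L[ℂ] H) (K : Set ℝ) : Set H :=
  {v | ∀ f : ℝ → ℝ, Continuous f → (∀ t ∈ K, f t = 0) → cfc f a v = 0}

/-- The spectral subspace of a self-adjoint operator `a` for a Borel set `Δ ⊆ ℝ`: the closed linear
span of the vectors whose spectral measure is concentrated on some closed subset of `Δ` (the
spectral measures are finite Borel measures on `ℝ`, hence inner regular, so that this is the range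
of the value at `Δ` of the projection-valued spectral measure of `a`). -/
def spectralSubspace (a : H →L[ℂ] H) (Δ : Set ℝ) : Submodule ℂ H :=
  (Submodule.span ℂ {v | ∃ K ⊆ Δ, IsClosed K ∧ v ∈ spectrallySupported a K}).topologicalClosure

/-- The spectral projection `χ_Δ(a)` of a self-adjoint operator `a`, for a Borel set `Δ ⊆ ℝ`: the
orthogonal projection onto the spectral subspace. -/
def spectralProjection (a : H →L[ℂ] H) (Δ : Set ℝ) : H →L[ℂ] H :=
  haveI : CompleteSpace (spectralSubspace a Δ) :=
    inferInstanceAs (CompleteSpace (Submodule.topologicalClosure _))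
  (spectralSubspace a Δ).starProjection

/-- The spectral resolution `(e^a_x)_{x ∈ ℝ}` of a self-adjoint operator `a`,
`e^a_x = χ_{(-∞, x]}(a)`. -/
def spectralResolution (a : H →L[ℂ] H) (x : ℝ) : H →L[ℂ] H :=
  spectralProjection a (Iic x)

/-- The spectral order on self-adjoint operators: `a ≤ₛ b` iff `e^a_x ≥ e^b_x` for all real `x`
(the order of projections is the usual order of operators). -/
def SpectralLE (a b : H →L[ℂ] H) : Prop :=
  ∀ x : ℝ, spectralResolution b x ≤ spectralResolution a x

end Spectral

/-! ### Contexts and daseinisation -/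

variable {H : Type*} [NormedAddCommGroup H] [InnerProductSpace ℂ H] [CompleteSpace H]

/-- The poset of contexts of a von Neumann algebra `A`: the abelian von Neumann subalgebras of `A`
(with the same unit), ordered by inclusion. -/
abbrev Context (A : VonNeumannAlgebra H) : Type _ :=
  {C : VonNeumannAlgebra H // C ≤ A ∧ ∀ x ∈ C, ∀ y ∈ C, x * y = y * x}

variable {A : VonNeumannAlgebra H}

/-- The algebra of a context, as a star subalgebra of the bounded operators. -/
abbrev Context.alg (C : Context A) : StarSubalgebra ℂ (H →L[ℂ] H) := C.1.toStarSubalgebra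

/-- `C_sa`, the self-adjoint elements of a context with the usual order of operators. -/
abbrev Context.SelfAdj (C : Context A) : Type _ :=
  {b : H →L[ℂ] H // b ∈ C.alg ∧ IsSelfAdjoint b}

/-- `Proj(C)`, the projections in a context with the usual order of operators. -/
abbrev Context.Proj (C : Context A) : Type _ :=
  {q : H →L[ℂ] H // q ∈ C.alg ∧ IsStarProjection q}

instance (C : Context A) : Nonempty C.SelfAdj := ⟨⟨0, zero_mem _, .zero _⟩⟩

instance (C : Context A) : Nonempty C.Proj := ⟨⟨0, zero_mem _, .zero _⟩⟩

/-- The projections in `C` that dominate `p`. -/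
def projAbove (p : H →L[ℂ] H) (C : Context A) : Set C.Proj := {q | p ≤ q.1}

/-- The self-adjoint elements of `C` that lie above `a` in the spectral order. -/
def spectrallyAbove (a : H →L[ℂ] H) (C : Context A) : Set C.SelfAdj := {b | SpectralLE a b.1}

/-- The self-adjoint elements of `C` that lie below `a` in the spectral order. -/
def spectrallyBelow (a : H →L[ℂ] H) (C : Context A) : Set C.SelfAdj := {b | SpectralLE b.1 a}

/-- Outer daseinisation of a projection: `δᵒ(p)_C = ⋀ {q ∈ Proj(C) | q ≥ p}`, the meet being taken
in `Proj(C)`. -/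
def outerDasProj (p : H →L[ℂ] H) (C : Context A) : C.Proj :=
  Classical.epsilon (IsGLB (projAbove p C))

/-- Outer daseinisation of a self-adjoint operator: `δᵒ(a)_C = ⋀ {b ∈ C_sa | b ≥ₛ a}`, the meet
being taken in `C_sa` (where the spectral order and the usual order coincide). -/
def outerDas (a : H →L[ℂ] H) (C : Context A) : C.SelfAdj :=
  Classical.epsilon (IsGLB (spectrallyAbove a C))

/-- Inner daseinisation of a self-adjoint operator: `δⁱ(a)_C = ⋁ {b ∈ C_sa | b ≤ₛ a}`, the join
being taken in `C_sa` (where the spectral order and the usual order coincide). -/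
def innerDas (a : H →L[ℂ] H) (C : Context A) : C.SelfAdj :=
  Classical.epsilon (IsLUB (spectrallyBelow a C))

/-! ### The state space -/

/-- The Gelfand spectrum `Σ_C` of a context: the characters of `C`, with the weak-* topology. -/
abbrev Context.Spectrum (C : Context A) : Type _ := WeakDual.characterSpace ℂ C.alg

/-- A von Neumann algebra is norm closed (it is a commutant), hence complete. -/
instance (C : Context A) : CompleteSpace C.alg := by
  have h : IsClosed (C.alg : Set (H →L[ℂ] H)) := by
    have := Set.isClosed_centralizer (Set.centralizer (C.alg : Set (H →L[ℂ] H)))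
    rwa [show Set.centralizer (Set.centralizer (C.alg : Set (H →L[ℂ] H))) = C.alg from
      C.1.centralizer_centralizer'] at this
  exact h.completeSpace_coe

/-- The restriction `ρ_{CD} : Σ_C → Σ_D`, `λ ↦ λ|_D`, for contexts `D ⊆ C`. -/
def Context.restrict {D C : Context A} (h : D ≤ C) : C(C.Spectrum, D.Spectrum) :=
  WeakDual.CharacterSpace.compContinuousMap (StarSubalgebra.inclusion (S₁ := D.alg) (S₂ := C.alg) h)

theorem Context.restrict_apply {D C : Context A} (h : D ≤ C) (l : C.Spectrum) (x : D.alg) :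
    Context.restrict h l x = l (⟨x.1, h x.2⟩ : C.alg) :=
  rfl

variable (A) in
/-- The set underlying `Σ_↓`: the disjoint union of the Gelfand spectra of all contexts. -/
def StateSpace : Type _ := Σ C : Context A, C.Spectrum

/-- The topology of `Σ_↓`: `U` is open iff it is closed under restriction of characters to smaller
contexts and each `U_C` is open in the Gelfand spectrum `Σ_C`. -/
instance : TopologicalSpace (StateSpace A) where
  IsOpen U :=
    (∀ (C D : Context A) (h : D ≤ C) (l : C.Spectrum),
      (⟨C, l⟩ : StateSpace A) ∈ U → (⟨D, Context.restrict h l⟩ : StateSpace A) ∈ U) ∧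
    ∀ C : Context A, IsOpen {l : C.Spectrum | (⟨C, l⟩ : StateSpace A) ∈ U}
  isOpen_univ := ⟨fun _ _ _ _ _ => mem_univ _, fun _ => isOpen_univ⟩
  isOpen_inter U V hU hV :=
    ⟨fun C D h l hl => ⟨hU.1 C D h l hl.1, hV.1 C D h l hl.2⟩,
      fun C => (hU.2 C).inter (hV.2 C)⟩
  isOpen_sUnion S hS := by
    refine ⟨fun C D h l hl => ?_, fun C => ?_⟩
    · obtain ⟨U, hU, hl⟩ := hl
      exact ⟨U, hU, (hS U hU).1 C D h l hl⟩
    · have : {l : C.Spectrum | (⟨C, l⟩ : StateSpace A) ∈ ⋃₀ S} =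
          ⋃ U ∈ S, {l : C.Spectrum | (⟨C, l⟩ : StateSpace A) ∈ U} := by
        ext l
        simp only [mem_iUnion, mem_ofPred_eq, exists_prop]
        exact mem_sUnion
      rw [this]
      exact isOpen_biUnion fun U hU => (hS U hU).2 C

/-- The pairing `⟨λ, b⟩ = λ(b)` of a character of `C` with a self-adjoint element of `C`
(a real number). -/
def pairing {C : Context A} (l : C.Spectrum) (b : C.SelfAdj) : ℝ :=
  (l (⟨b.1, b.2.1⟩ : C.alg)).re

/-- The elementary proposition `[a ∈ Δ] = {(C, λ) | ⟨λ, δᵒ(χ_Δ(a))_C⟩ = 1}`. -/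
def elementaryProp (A : VonNeumannAlgebra H) (a : H →L[ℂ] H) (Δ : Set ℝ) : Set (StateSpace A) :=
  {x | x.2 (⟨(outerDasProj (spectralProjection a Δ) x.1).1,
    (outerDasProj (spectralProjection a Δ) x.1).2.1⟩ : x.1.alg) = 1}

/-! ### The value space and the daseinisation map -/

/-- The upper reals `ℝ_u`: extended reals, with topology generated by the sets `[-∞, y)`. -/
abbrev UpperReals : Type := Topology.WithLower EReal

/-- The lower reals `ℝ_l`: extended reals, with topology generated by the sets `(y, +∞]`. -/
abbrev LowerReals : Type := Topology.WithUpper EReal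

/-- The space `C_↓ × ℝ_u × ℝ_l`, where the open sets of `C_↓` are the down-closed sets of
contexts. -/
abbrev ValueSpace (A : VonNeumannAlgebra H) : Type _ :=
  Topology.WithLowerSet (Context A) × UpperReals × LowerReals

/-- The paired daseinisation map
`δ(a) : Σ_↓ → C_↓ × ℝ_u × ℝ_l`, `(C, λ) ↦ (C, ⟨λ, δⁱ(a)_C⟩, ⟨λ, δᵒ(a)_C⟩)`. -/
def das (A : VonNeumannAlgebra H) (a : H →L[ℂ] H) (x : StateSpace A) : ValueSpace A :=
  (Topology.WithLowerSet.toLowerSet x.1,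
    Topology.WithLower.toLower ((pairing x.2 (innerDas a x.1) : ℝ) : EReal),
    Topology.WithUpper.toUpper ((pairing x.2 (outerDas a x.1) : ℝ) : EReal))

/-- The open set `C × [-∞, r) × (s, +∞]` of the value space. -/
def hatOpen (A : VonNeumannAlgebra H) (r s : ℝ) : Opens (ValueSpace A) where
  carrier := univ ×ˢ
    ({x | Topology.WithLower.ofLower x < (r : EReal)} ×ˢ
      {y | (s : EReal) < Topology.WithUpper.ofUpper y})
  is_open' := by
    refine isOpen_univ.prod (IsOpen.prod ?_ ?_)
    · refine GenerateOpen.basic _ ⟨Topology.WithLower.toLower (r : EReal), ?_⟩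
      ext x
      simp only [mem_compl_iff, mem_Ici, not_le, mem_ofPred_eq]
      exact Iff.rfl
    · refine GenerateOpen.basic _ ⟨Topology.WithUpper.toUpper (s : EReal), ?_⟩
      ext y
      simp only [mem_compl_iff, mem_Iic, not_le, mem_ofPred_eq]
      exact Iff.rfl

/-- The enlargement `C × [-∞, r + ε) × (s - ε, +∞]` of `hatOpen A r s` by `ε`. -/
def hatOpenAdd (A : VonNeumannAlgebra H) (r s ε : ℝ) : Opens (ValueSpace A) :=
  hatOpen A (r + ε) (s - ε)

end ContravariantModel

end

/-! Everything is tested on two-valued operators `r • q + m • (1 - q)` with `q` a projection of the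
context `C`. A character sends `q` to 0 or 1, so it sends such an operator to `m` or `r`.

For the first inclusion let `q` be the outer daseinisation of `χ_{(-∞,r)}(a)` and suppose `λ(q) =
0`. Since `q` dominates all spectral projections of `a` below `r`, the operator `-‖a‖ • q + r • (1 -
q)` lies spectrally below `a`, hence below `δⁱ(a)_C`, and applying `λ` gives `r ≤ λ(δⁱ(a)_C)`.
Dually, for `χ_{(s,∞)}(a)` the operator `‖a‖ • q + s • (1 - q)` lies spectrally above `a`.

For the second inclusion suppose `λ(q) = 1`. If `b` in `C` is spectrally below `a`, then
`χ_{(-∞,r]}(b)` is a projection of `C` dominating `χ_{(-∞,r)}(a)`, hence dominating `q`, so `b ≤ r •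
q + ‖a‖ • (1 - q)`. This bound passes to the supremum, and `λ(δⁱ(a)_C) ≤ r`. The outer case is dual.
The bounds are not strict, which is the only reason for `ε`.

Continuity amounts to `δⁱ(a)_D ≤ δⁱ(a)_C` and `δᵒ(a)_C ≤ δᵒ(a)_D` for `D ⊆ C`. A supremum formed in
`D` must then be compared with an element of `C`, so suprema are shown to be least among all
self-adjoint operators commuting with the context (`Context.exists_isLUB_selfAdj`). -/

noncomputable section

namespace ContravariantModel

open Set TopologicalSpace

/-! ### Quadratic forms, projections and eigenvectors -/

section Operators

variable {H : Type*} [NormedAddCommGroup H] [InnerProductSpace ℂ H]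

local notation "⟪" x ", " y "⟫" => inner ℂ x y

theorem reApplyInnerSelf_sub (a b : H →L[ℂ] H) (v : H) :
    (a - b).reApplyInnerSelf v = a.reApplyInnerSelf v - b.reApplyInnerSelf v := by
  simp [ContinuousLinearMap.reApplyInnerSelf_apply, inner_sub_left]

theorem reApplyInnerSelf_real_smul (r : ℝ) (a : H →L[ℂ] H) (v : H) :
    (r • a).reApplyInnerSelf v = r * a.reApplyInnerSelf v := by
  rw [← Complex.coe_smul, ContinuousLinearMap.reApplyInnerSelf_apply,
    ContinuousLinearMap.reApplyInnerSelf_apply, smul_apply, inner_smul_left]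
  simp

theorem reApplyInnerSelf_one (v : H) : (1 : H →L[ℂ] H).reApplyInnerSelf v = ‖v‖ ^ 2 := by
  rw [ContinuousLinearMap.reApplyInnerSelf_apply, one_apply_eq_self]
  exact (norm_sq_eq_re_inner (𝕜 := ℂ) v).symm

theorem reApplyInnerSelf_mono {a b : H →L[ℂ] H} (h : a ≤ b) (v : H) :
    a.reApplyInnerSelf v ≤ b.reApplyInnerSelf v := by
  have := ((ContinuousLinearMap.le_def a b).1 h).2 v
  have h2 : 0 ≤ (b - a).reApplyInnerSelf v := this
  rw [reApplyInnerSelf_sub] at h2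
  linarith

variable [CompleteSpace H]

theorem le_of_reApplyInnerSelf_le {a b : H →L[ℂ] H} (ha : IsSelfAdjoint a) (hb : IsSelfAdjoint b)
    (h : ∀ v, a.reApplyInnerSelf v ≤ b.reApplyInnerSelf v) : a ≤ b := by
  rw [ContinuousLinearMap.le_def, ContinuousLinearMap.isPositive_def']
  refine ⟨hb.sub ha, fun v => ?_⟩
  rw [reApplyInnerSelf_sub]
  linarith [h v]

theorem starProjection_le_iff {U : Submodule ℂ H} [U.HasOrthogonalProjection] {q : H →L[ℂ] H}
    (hq : IsStarProjection q) : U.starProjection ≤ q ↔ ∀ v ∈ U, q v = v := by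
  obtain ⟨V, hV, rfl⟩ := isStarProjection_iff_eq_starProjection.1 hq
  rw [Submodule.starProjection_le_starProjection_iff]
  simp only [Submodule.starProjection_eq_self_iff]
  exact Iff.rfl

theorem le_starProjection_iff {U : Submodule ℂ H} [U.HasOrthogonalProjection] {q : H →L[ℂ] H}
    (hq : IsStarProjection q) : q ≤ U.starProjection ↔ ∀ v, q v = v → v ∈ U := by
  obtain ⟨V, hV, rfl⟩ := isStarProjection_iff_eq_starProjection.1 hq
  rw [Submodule.starProjection_le_starProjection_iff]
  simp only [Submodule.starProjection_eq_self_iff]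
  exact Iff.rfl

theorem apply_eq_self_of_le {p q : H →L[ℂ] H} (hp : IsStarProjection p) (hq : IsStarProjection q)
    (h : p ≤ q) {v : H} (hv : p v = v) : q v = v := by
  obtain ⟨V, hV, rfl⟩ := isStarProjection_iff_eq_starProjection.1 hp
  exact (starProjection_le_iff hq).1 h v (Submodule.starProjection_eq_self_iff.1 hv)

/-- A subspace invariant under `y` and its adjoint is reducing: invariance under the adjoint makes
`y` preserve the orthogonal complement as well. -/
theorem commute_starProjection {U : Submodule ℂ H} [U.HasOrthogonalProjection] {y : H →L[ℂ] H}
    (h : ∀ v ∈ U, y v ∈ U) (h' : ∀ v ∈ U, star y v ∈ U) : Commute U.starProjection y := by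
  ext v
  simp only [mul_apply_eq_comp]
  refine (Submodule.eq_starProjection_of_mem_orthogonal (h _ (U.starProjection_apply_mem v)) ?_)
  rw [← map_sub, Submodule.mem_orthogonal]
  intro u hu
  rw [← ContinuousLinearMap.adjoint_inner_left, ← ContinuousLinearMap.star_eq_adjoint]
  exact (Submodule.mem_orthogonal _ _).1 (Submodule.sub_starProjection_mem_orthogonal v) _ (h' u hu)

/-- An eigenvalue lies in the spectrum, so evaluation at `m` makes sense there. The claim holds for
polynomials in `a` and survives norm limits, so Stone–Weierstrass gives all continuous functions. -/
theorem cfc_apply_eq_smul {a : H →L[ℂ] H} (ha : IsSelfAdjoint a) {f : ℝ → ℝ} (hf : Continuous f)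
    {m : ℝ} {v : H} (hv : a v = m • v) : cfc f a v = f m • v := by
  by_cases hv0 : v = 0
  · simp [hv0]
  have hm : m ∈ spectrum ℝ a := by
    rw [spectrum.mem_iff]
    rintro ⟨u, hu⟩
    have h0 : (u : H →L[ℂ] H) v = 0 := by
      rw [hu, Algebra.algebraMap_eq_smul_one, sub_apply, hv, smul_apply, one_apply_eq_self, sub_self]
    have h1 := DFunLike.congr_fun u.inv_mul v
    rw [mul_apply_eq_comp, h0, map_zero, one_apply_eq_self] at h1
    exact hv0 h1.symm
  have key : ∀ g : C(spectrum ℝ a, ℝ), cfcHom (R := ℝ) ha g v = g ⟨m, hm⟩ • v := by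
    intro g
    induction g using ContinuousMap.induction_on_of_compact with
    | const r =>
      have : (ContinuousMap.const (spectrum ℝ a) r) = algebraMap ℝ C(spectrum ℝ a, ℝ) r := rfl
      rw [this, AlgHomClass.commutes, Algebra.algebraMap_eq_smul_one]
      rfl
    | id => rw [cfcHom_id]; exact hv
    | star_id => rw [star_trivial, cfcHom_id]; exact hv
    | add f g hf hg => rw [map_add, add_apply, hf, hg, ContinuousMap.add_apply, add_smul]
    | mul f g hf hg =>
      rw [map_mul, mul_apply_eq_comp, hg, ContinuousLinearMap.map_smul_of_tower, hf, ContinuousMap.mul_apply,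
        smul_smul, mul_comm]
    | frequently f h =>
      refine h.mem_of_closed (isClosed_eq ?_ ?_)
      · exact (ContinuousLinearMap.apply ℂ H v).continuous.comp (cfcHom_continuous (R := ℝ) ha)
      · exact Continuous.smul (f := fun g : C(spectrum ℝ a, ℝ) => g ⟨m, hm⟩)
          (continuous_eval_const _) continuous_const
  rw [cfc_apply f a ha hf.continuousOn, key]
  rfl

end Operators

/-! ### Spectral subspaces of a self-adjoint operator -/

section Spectral

variable {H : Type*} [NormedAddCommGroup H] [InnerProductSpace ℂ H] [CompleteSpace H]
  {a : H →L[ℂ] H}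

local notation "⟪" x ", " y "⟫" => inner ℂ x y

theorem inner_cfc_left (a : H →L[ℂ] H) (f : ℝ → ℝ) (v w : H) :
    ⟪cfc f a v, w⟫ = ⟪v, cfc f a w⟫ := by
  have h : IsSelfAdjoint (cfc f a) := cfc_predicate f a
  have h3 := ContinuousLinearMap.adjoint_inner_left (cfc f a) w v
  rwa [← ContinuousLinearMap.star_eq_adjoint, h.star_eq] at h3

theorem isClosed_spectrallySupported (a : H →L[ℂ] H) (K : Set ℝ) :
    IsClosed (spectrallySupported a K) := by
  simp only [spectrallySupported, ofPred_forall]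
  exact isClosed_iInter fun f => isClosed_iInter fun _ => isClosed_iInter fun _ =>
    isClosed_eq (cfc f a).continuous continuous_const

theorem spectrallySupported_mono (a : H →L[ℂ] H) {K L : Set ℝ} (h : K ⊆ L) :
    spectrallySupported a K ⊆ spectrallySupported a L :=
  fun _ hv f hf h0 => hv f hf fun t ht => h0 t (h ht)

theorem spectralSubspace_mono (a : H →L[ℂ] H) {Δ Γ : Set ℝ} (h : Δ ⊆ Γ) :
    spectralSubspace a Δ ≤ spectralSubspace a Γ :=
  Submodule.topologicalClosure_mono <| Submodule.span_mono
    fun _ ⟨K, hK, hc, hv⟩ => ⟨K, hK.trans h, hc, hv⟩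

theorem spectrallySupported_subset_spectralSubspace (a : H →L[ℂ] H) {K Δ : Set ℝ} (hK : IsClosed K)
    (h : K ⊆ Δ) : spectrallySupported a K ⊆ spectralSubspace a Δ :=
  fun _ hv => Submodule.le_topologicalClosure _ (Submodule.subset_span ⟨K, h, hK, hv⟩)

theorem spectralSubspace_le {Δ : Set ℝ} {U : Submodule ℂ H} (hU : IsClosed (U : Set H))
    (h : ∀ K ⊆ Δ, IsClosed K → ∀ v ∈ spectrallySupported a K, v ∈ U) : spectralSubspace a Δ ≤ U :=
  Submodule.topologicalClosure_minimal _
    (Submodule.span_le.2 fun _ ⟨K, hK, hc, hv⟩ => h K hK hc _ hv) hU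

theorem spectralSubspace_coe_eq_of_isClosed (a : H →L[ℂ] H) {K : Set ℝ} (hK : IsClosed K) :
    (spectralSubspace a K : Set H) = spectrallySupported a K := by
  refine Subset.antisymm ?_ (spectrallySupported_subset_spectralSubspace a hK Subset.rfl)
  let U : Submodule ℂ H :=
    { carrier := spectrallySupported a K
      add_mem' := fun hv hw f hf h0 => by rw [map_add, hv f hf h0, hw f hf h0, add_zero]
      zero_mem' := fun f _ _ => map_zero _
      smul_mem' := fun c v hv f hf h0 => by rw [map_smul, hv f hf h0, smul_zero] }
  exact spectralSubspace_le (U := U) (isClosed_spectrallySupported a K)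
    fun L hL _ v hv => spectrallySupported_mono a hL hv

/-- On generators this is Urysohn: with `f = 1` on `K` and `f = 0` on `L`, `f(a)` fixes `v`, kills
`w` and is symmetric. -/
theorem inner_eq_zero_of_disjoint (ha : IsSelfAdjoint a) {Δ Γ : Set ℝ} (h : Disjoint Δ Γ) {v w : H}
    (hv : v ∈ spectralSubspace a Δ) (hw : w ∈ spectralSubspace a Γ) : ⟪v, w⟫ = 0 := by
  suffices spectralSubspace a Δ ≤ (spectralSubspace a Γ)ᗮ from
    (Submodule.mem_orthogonal' _ _).1 (this hv) w hw
  refine spectralSubspace_le (Submodule.isClosed_orthogonal _) fun K hK hKc v hv => ?_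
  have : spectralSubspace a Γ ≤ (ℂ ∙ v)ᗮ := by
    refine spectralSubspace_le (Submodule.isClosed_orthogonal _) fun L hL hLc w hw => ?_
    rw [Submodule.mem_orthogonal_singleton_iff_inner_right]
    obtain ⟨f, hfK, hfL, -⟩ := exists_continuous_zero_one_of_isClosed hLc hKc
      (h.mono hK hL).symm
    have hv' := hv (fun t => 1 - f t) (by fun_prop) fun t ht => by simp [hfL ht]
    rw [cfc_sub (fun _ => 1) f a, cfc_const_one ℝ a, sub_apply, one_apply_eq_self,
      sub_eq_zero] at hv'
    rw [hv', inner_cfc_left, hw f f.continuous hfK, inner_zero_right]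
  rw [Submodule.mem_orthogonal']
  exact fun w hw => Submodule.mem_orthogonal_singleton_iff_inner_right.1 (this hw)

/-- If `f` vanishes off `U`, then up to a uniformly small error `f` lives on a closed subset of `U`.
That part of `f(a)w` lies in the spectral subspace of `U`, so it is orthogonal to `v`, and hence so
is `f(a)w` in the limit. -/
theorem mem_spectralSubspace_compl (a : H →L[ℂ] H) {U : Set ℝ} (hU : IsOpen U) {v : H}
    (hv : v ∈ (spectralSubspace a U)ᗮ) : v ∈ spectralSubspace a Uᶜ := by
  rw [← SetLike.mem_coe, spectralSubspace_coe_eq_of_isClosed a hU.isClosed_compl]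
  intro f hf h0
  refine ext_inner_left ℂ fun w => ?_
  rw [inner_zero_right, ← inner_cfc_left]
  refine norm_le_zero_iff.1 (le_of_forall_pos_le_add fun ε hε => ?_)
  obtain ⟨δ, hδ, hδε⟩ : ∃ δ > 0, δ * (‖w‖ * ‖v‖) ≤ ε := by
    refine ⟨ε / (‖w‖ * ‖v‖ + 1), by positivity, ?_⟩
    rw [div_mul_eq_mul_div, div_le_iff₀ (by positivity)]
    nlinarith [norm_nonneg w, norm_nonneg v, mul_nonneg (norm_nonneg w) (norm_nonneg v)]
  -- truncate `f` to `g`, supported on the closed set where `δ ≤ |f|`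
  let c : ℝ → ℝ := fun t => max (-δ) (min δ (f t))
  have hc : Continuous c := by fun_prop
  have hcδ : ∀ t, |c t| ≤ δ := fun t =>
    abs_le.2 ⟨le_max_left _ _, max_le (by linarith) (min_le_left _ _)⟩
  have hmem : cfc (fun t => f t - c t) a w ∈ spectralSubspace a U := by
    refine spectrallySupported_subset_spectralSubspace a (K := {t | δ ≤ |f t|})
      (isClosed_le continuous_const hf.abs) (fun t ht => ?_) ?_
    · by_contra hU
      have : f t = 0 := h0 t hU
      rw [mem_ofPred_eq, this, abs_zero] at ht
      linarith
    · intro g hg hg0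
      rw [← mul_apply_eq_comp, ← cfc_mul g (fun t => f t - c t) a hg.continuousOn
        (hf.sub hc).continuousOn]
      have : (fun t => g t * (f t - c t)) = fun _ => 0 := by
        funext t
        by_cases ht : δ ≤ |f t|
        · rw [hg0 t ht, zero_mul]
        · have h1 := abs_lt.1 (not_le.1 ht)
          have : c t = f t := by
            simp only [c]
            rw [min_eq_right h1.2.le, max_eq_right h1.1.le]
          rw [this, sub_self, mul_zero]
      rw [this, cfc_const_zero]
      rfl
  have hz : ⟪cfc (fun t => f t - c t) a w, v⟫ = 0 := (Submodule.mem_orthogonal _ _).1 hv _ hmem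
  rw [cfc_sub f c a hf.continuousOn hc.continuousOn, sub_apply, inner_sub_left, sub_eq_zero] at hz
  rw [hz, zero_add]
  calc ‖⟪cfc c a w, v⟫‖ ≤ ‖cfc c a w‖ * ‖v‖ := norm_inner_le_norm _ _
    _ ≤ (‖cfc c a‖ * ‖w‖) * ‖v‖ := by gcongr; exact (cfc c a).le_opNorm w
    _ ≤ (δ * ‖w‖) * ‖v‖ := by
      gcongr
      exact norm_cfc_le hδ.le fun t _ => hcδ t
    _ ≤ ε := by rw [mul_assoc]; exact hδε

theorem apply_mem_spectralSubspace {y : H →L[ℂ] H} (h : Commute a y) {Δ : Set ℝ} {v : H}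
    (hv : v ∈ spectralSubspace a Δ) : y v ∈ spectralSubspace a Δ := by
  suffices spectralSubspace a Δ ≤ (spectralSubspace a Δ).comap (y : H →ₗ[ℂ] H) from this hv
  refine spectralSubspace_le ?_ fun K hK hKc v hv => ?_
  · exact (Submodule.isClosed_topologicalClosure _).preimage y.continuous
  · refine spectrallySupported_subset_spectralSubspace a hKc hK fun f hf h0 => ?_
    have := DFunLike.congr_fun (h.cfc_real f).eq v
    rw [mul_apply_eq_comp, mul_apply_eq_comp, hv f hf h0, map_zero] at this
    exact this

/-- The positive part of `a - r` dominates `a - r` and annihilates `v`. -/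
theorem reApplyInnerSelf_le_of_mem (ha : IsSelfAdjoint a) {r : ℝ} {v : H}
    (hv : v ∈ spectralSubspace a (Iic r)) : a.reApplyInnerSelf v ≤ r * ‖v‖ ^ 2 := by
  rw [← SetLike.mem_coe, spectralSubspace_coe_eq_of_isClosed a isClosed_Iic] at hv
  have h1 := hv (fun t => max (t - r) 0) (by fun_prop) fun t ht => max_eq_right (by simpa using ht)
  have h2 : a - r • 1 ≤ cfc (fun t => max (t - r) 0) a := by
    have : a - r • 1 = cfc (fun t : ℝ => t - r) a := by
      rw [cfc_sub (fun t => t) (fun _ => r) a, cfc_id' ℝ a, cfc_const r a,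
        Algebra.algebraMap_eq_smul_one]
    rw [this]
    exact cfc_mono fun t _ => le_max_left _ _
  have h3 := reApplyInnerSelf_mono h2 v
  rw [reApplyInnerSelf_sub, reApplyInnerSelf_real_smul, reApplyInnerSelf_one,
    ContinuousLinearMap.reApplyInnerSelf_apply (cfc _ a), h1, inner_zero_left, map_zero] at h3
  linarith

theorem le_reApplyInnerSelf_of_mem (ha : IsSelfAdjoint a) {r : ℝ} {v : H}
    (hv : v ∈ spectralSubspace a (Ici r)) : r * ‖v‖ ^ 2 ≤ a.reApplyInnerSelf v := by
  rw [← SetLike.mem_coe, spectralSubspace_coe_eq_of_isClosed a isClosed_Ici] at hv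
  have h1 := hv (fun t => min (t - r) 0) (by fun_prop) fun t ht => min_eq_right (by simpa using ht)
  have h2 : cfc (fun t => min (t - r) 0) a ≤ a - r • 1 := by
    have : a - r • 1 = cfc (fun t : ℝ => t - r) a := by
      rw [cfc_sub (fun t => t) (fun _ => r) a, cfc_id' ℝ a, cfc_const r a,
        Algebra.algebraMap_eq_smul_one]
    rw [this]
    exact cfc_mono fun t _ => min_le_left _ _
  have h3 := reApplyInnerSelf_mono h2 v
  rw [reApplyInnerSelf_sub, reApplyInnerSelf_real_smul, reApplyInnerSelf_one,
    ContinuousLinearMap.reApplyInnerSelf_apply (cfc _ a), h1, inner_zero_left, map_zero] at h3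
  linarith

theorem abs_le_norm_of_mem_spectrum (ha : IsSelfAdjoint a) {t : ℝ} (ht : t ∈ spectrum ℝ a) :
    |t| ≤ ‖a‖ := by
  simpa [cfc_id' ℝ a] using norm_apply_le_norm_cfc (fun t : ℝ => t) a ht

theorem spectralSubspace_Iic_eq_top (ha : IsSelfAdjoint a) {x : ℝ} (hx : ‖a‖ ≤ x) :
    spectralSubspace a (Iic x) = ⊤ := by
  rw [eq_top_iff]
  intro v _
  refine spectrallySupported_subset_spectralSubspace a isClosed_Iic Subset.rfl fun f hf h0 => ?_
  have : cfc f a = cfc (fun _ : ℝ => (0 : ℝ)) a := cfc_congr fun t ht => h0 t <|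
    (le_abs_self t).trans ((abs_le_norm_of_mem_spectrum ha ht).trans hx)
  rw [this, cfc_const_zero]
  rfl

/-- The inequality must be strict, because `-‖a‖` can be an eigenvalue. This is the source of the
constant `-‖a‖ - 1` in the lower bounds below. -/
theorem spectralSubspace_Iic_eq_bot (ha : IsSelfAdjoint a) {x : ℝ} (hx : x < -‖a‖) :
    spectralSubspace a (Iic x) = ⊥ := by
  rw [eq_bot_iff]
  intro v hv
  rw [← SetLike.mem_coe, spectralSubspace_coe_eq_of_isClosed a isClosed_Iic] at hv
  obtain ⟨f, hf0, hf1, -⟩ := exists_continuous_zero_one_of_isClosed (isClosed_Iic (a := x))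
    (isClosed_Ici (a := -‖a‖)) (by
      rw [Set.disjoint_left]; intro t ht ht'; exact (ht.trans_lt hx).not_ge ht')
  have h := hv f f.continuous hf0
  have : cfc f a = cfc (fun _ : ℝ => (1 : ℝ)) a := cfc_congr fun t ht => hf1 <|
    neg_le_of_abs_le (abs_le_norm_of_mem_spectrum ha ht)
  rwa [this, cfc_const_one ℝ a, one_apply_eq_self] at h

/-- The spectral projection is the orthogonal projection onto the spectral subspace. -/
theorem isStarProjection_spectralProjection (a : H →L[ℂ] H) (Δ : Set ℝ) :
    IsStarProjection (spectralProjection a Δ) := by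
  have : CompleteSpace (spectralSubspace a Δ) :=
    inferInstanceAs (CompleteSpace (Submodule.topologicalClosure _))
  exact isStarProjection_starProjection

theorem spectralProjection_le_iff {Δ : Set ℝ} {q : H →L[ℂ] H} (hq : IsStarProjection q) :
    spectralProjection a Δ ≤ q ↔ ∀ v ∈ spectralSubspace a Δ, q v = v := by
  have : CompleteSpace (spectralSubspace a Δ) :=
    inferInstanceAs (CompleteSpace (Submodule.topologicalClosure _))
  exact starProjection_le_iff hq

theorem spectralProjection_apply_eq_self_iff {a : H →L[ℂ] H} {Δ : Set ℝ} {v : H} :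
    spectralProjection a Δ v = v ↔ v ∈ spectralSubspace a Δ := by
  have : CompleteSpace (spectralSubspace a Δ) :=
    inferInstanceAs (CompleteSpace (Submodule.topologicalClosure _))
  exact Submodule.starProjection_eq_self_iff

theorem spectralProjection_apply_eq_zero_iff {a : H →L[ℂ] H} {Δ : Set ℝ} {v : H} :
    spectralProjection a Δ v = 0 ↔ v ∈ (spectralSubspace a Δ)ᗮ := by
  have : CompleteSpace (spectralSubspace a Δ) :=
    inferInstanceAs (CompleteSpace (Submodule.topologicalClosure _))
  exact Submodule.starProjection_apply_eq_zero_iff (K := spectralSubspace a Δ)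

/-- Together with the double commutant theorem, this puts the spectral projections of an element of
a context into that context. -/
theorem commute_spectralProjection {y : H →L[ℂ] H} (h : Commute a y) (h' : Commute a (star y))
    (Δ : Set ℝ) : Commute (spectralProjection a Δ) y := by
  have : CompleteSpace (spectralSubspace a Δ) :=
    inferInstanceAs (CompleteSpace (Submodule.topologicalClosure _))
  exact commute_starProjection (fun v hv => apply_mem_spectralSubspace h hv)
    fun v hv => apply_mem_spectralSubspace h' hv

theorem spectralLE_iff {a b : H →L[ℂ] H} :
    SpectralLE a b ↔ ∀ x : ℝ, spectralSubspace b (Iic x) ≤ spectralSubspace a (Iic x) := by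
  refine forall_congr' fun x => ?_
  rw [spectralResolution, spectralResolution,
    spectralProjection_le_iff (isStarProjection_spectralProjection a _)]
  exact forall₂_congr fun v _ => spectralProjection_apply_eq_self_iff (a := a) (v := v)

end Spectral

/-! ### Weak limits of monotone nets -/

section MonotoneLimits

open Filter Topology

variable {H : Type*} [NormedAddCommGroup H] [InnerProductSpace ℂ H] [CompleteSpace H]

local notation "⟪" x ", " y "⟫" => inner ℂ x y

theorem isSelfAdjoint_of_inner {d : H →L[ℂ] H} (h : ∀ v w, ⟪d v, w⟫ = ⟪v, d w⟫) :
    IsSelfAdjoint d := by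
  rw [ContinuousLinearMap.isSelfAdjoint_iff_isSymmetric]
  exact h

theorem inner_apply_of_isSelfAdjoint {d : H →L[ℂ] H} (h : IsSelfAdjoint d) (v w : H) :
    ⟪d v, w⟫ = ⟪v, d w⟫ := by
  rw [ContinuousLinearMap.isSelfAdjoint_iff_isSymmetric] at h
  exact h v w

/-- A bounded increasing net of self-adjoint operators converges in the weak operator topology. -/
theorem exists_tendsto_inner_of_monotone {ι : Type*} [Preorder ι] [IsDirectedOrder ι] [Nonempty ι]
    {b : ι → H →L[ℂ] H} (hb : Monotone b) (hsa : ∀ i, IsSelfAdjoint (b i)) {M : H →L[ℂ] H}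
    (hM : ∀ i, b i ≤ M) :
    ∃ d : H →L[ℂ] H, ∀ v w, Tendsto (fun i => ⟪b i v, w⟫) atTop (𝓝 ⟪d v, w⟫) := by
  have hdiag : ∀ v, ∃ z, Tendsto (fun i => ⟪b i v, v⟫) atTop (𝓝 z) := by
    intro v
    have hm : Monotone fun i => (b i).reApplyInnerSelf v :=
      fun i j hij => reApplyInnerSelf_mono (hb hij) v
    have hbdd : BddAbove (range fun i => (b i).reApplyInnerSelf v) :=
      ⟨M.reApplyInnerSelf v, by rintro _ ⟨i, rfl⟩; exact reApplyInnerSelf_mono (hM i) v⟩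
    have := (Complex.continuous_ofReal.tendsto _).comp (tendsto_atTop_ciSup hm hbdd)
    refine ⟨_, this.congr fun i => ?_⟩
    exact LinearMap.IsSymmetric.coe_reApplyInnerSelf_apply
      ((ContinuousLinearMap.isSelfAdjoint_iff_isSymmetric).1 (hsa i)) v
  choose Q hQ using hdiag
  -- Polarization reduces the sesquilinear form to the diagonal, where the net is real, increasing
  -- and bounded.
  have hlim : ∀ v w, ∃ z, Tendsto (fun i => ⟪b i v, w⟫) atTop (𝓝 z) := fun v w =>
    ⟨_, ((((hQ (v + w)).sub (hQ (v - w))).sub ((hQ (v + Complex.I • w)).const_mul Complex.I)).add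
      ((hQ (v - Complex.I • w)).const_mul Complex.I)).div_const 4 |>.congr fun i =>
        (inner_map_polarization' (b i : H →ₗ[ℂ] H) v w).symm⟩
  choose B hB using hlim
  obtain ⟨i₀⟩ := ‹Nonempty ι›
  -- The net need not be bounded below, but the limit sees only the tail beyond `i₀`, where `0 ≤ M -
  -- b i ≤ M - b i₀` bounds the norms.
  have hnorm : ∀ v w, ‖B v w‖ ≤ (‖M‖ + ‖M - b i₀‖) * ‖v‖ * ‖w‖ := by
    intro v w
    refine le_of_tendsto (hB v w).norm ((eventually_ge_atTop i₀).mono fun i hi => ?_)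
    have h1 : ‖M - b i‖ ≤ ‖M - b i₀‖ :=
      CStarAlgebra.norm_le_norm_of_nonneg_of_le (sub_nonneg.2 (hM i)) (sub_le_sub_left (hb hi) M)
    have h2 : ‖b i‖ ≤ ‖M‖ + ‖M - b i₀‖ := by
      calc ‖b i‖ = ‖M - (M - b i)‖ := by rw [sub_sub_cancel]
        _ ≤ ‖M‖ + ‖M - b i‖ := norm_sub_le _ _
        _ ≤ _ := by gcongr
    calc ‖⟪b i v, w⟫‖ ≤ ‖b i v‖ * ‖w‖ := norm_inner_le_norm _ _
      _ ≤ ‖b i‖ * ‖v‖ * ‖w‖ := by gcongr; exact (b i).le_opNorm v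
      _ ≤ _ := by gcongr
  let F : H →ₗ⋆[ℂ] H →ₗ[ℂ] ℂ := LinearMap.mk₂'ₛₗ (starRingEnd ℂ) (RingHom.id ℂ) B
    (fun v v' w => tendsto_nhds_unique (hB (v + v') w) <|
      ((hB v w).add (hB v' w)).congr fun i => by rw [map_add, inner_add_left])
    (fun c v w => tendsto_nhds_unique (hB (c • v) w) <|
      ((hB v w).const_mul (starRingEnd ℂ c)).congr fun i => by rw [map_smul, inner_smul_left])
    (fun v w w' => tendsto_nhds_unique (hB v (w + w')) <|
      ((hB v w).add (hB v w')).congr fun i => by rw [inner_add_right])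
    (fun c v w => tendsto_nhds_unique (hB v (c • w)) <|
      ((hB v w).const_mul c).congr fun i => by rw [inner_smul_right])
  refine ⟨InnerProductSpace.continuousLinearMapOfBilin (F.mkContinuous₂ _ hnorm), fun v w => ?_⟩
  rw [InnerProductSpace.continuousLinearMapOfBilin_apply]
  exact hB v w

end MonotoneLimits

/-! ### Absolute value of a difference of commuting positive operators -/

section AbsoluteValue

variable {H : Type*} [NormedAddCommGroup H] [InnerProductSpace ℂ H] [CompleteSpace H]

/-- In a commutative algebra of self-adjoint operators, `|x - y| ≤ x + y` for positive `x`, `y`. -/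
theorem cfc_abs_sub_le_add {x y : H →L[ℂ] H} (hx : 0 ≤ x) (hy : 0 ≤ y) (hxy : Commute x y) :
    cfc (fun t : ℝ => |t|) (x - y) ≤ x + y := by
  have hz : IsSelfAdjoint (x - y) := (IsSelfAdjoint.of_nonneg hx).sub (IsSelfAdjoint.of_nonneg hy)
  have h1 : cfc (fun t : ℝ => |t|) (x - y) * cfc (fun t : ℝ => |t|) (x - y) =
      (x - y) * (x - y) := by
    rw [← cfc_mul (fun t : ℝ => |t|) (fun t : ℝ => |t|) (x - y)]
    simp only [abs_mul_abs_self]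
    rw [cfc_mul (fun t : ℝ => t) (fun t : ℝ => t) (x - y), cfc_id' ℝ (x - y)]
  have h2 : (x - y) * (x - y) ≤ (x + y) * (x + y) := by
    have : (x + y) * (x + y) - (x - y) * (x - y) = (4 : ℝ) • (x * y) := by
      have h := hxy.eq
      simp only [add_mul, mul_add, sub_mul, mul_sub, ← h]
      module
    rw [← sub_nonneg, this]
    exact smul_nonneg (by norm_num) (hxy.mul_nonneg hx hy)
  have h3 : 0 ≤ cfc (fun t : ℝ => |t|) (x - y) := cfc_nonneg fun t _ => abs_nonneg t
  -- The squares differ by `4xy`, which is positive because `x` and `y` commute; the square root is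
  -- operator monotone.
  rw [← CFC.sqrt_mul_self (x + y) (add_nonneg hx hy), ← CFC.sqrt_mul_self _ h3, h1]
  exact CFC.sqrt_le_sqrt _ _ h2

end AbsoluteValue

/-! ### Order completeness of contexts -/

section Contexts

open Filter Topology

variable {H : Type*} [NormedAddCommGroup H] [InnerProductSpace ℂ H] [CompleteSpace H]
  {A : VonNeumannAlgebra H}

local notation "⟪" x ", " y "⟫" => inner ℂ x y

/-- The double commutant theorem. As the commutant is closed under adjoints, `star y` may also be
assumed to commute with `C`, as reducing subspaces require. -/
theorem Context.mem_alg_of_commute (C : Context A) {b : H →L[ℂ] H}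
    (h : ∀ y, (∀ x ∈ C.alg, Commute x y) → (∀ x ∈ C.alg, Commute x (star y)) → Commute b y) :
    b ∈ C.alg := by
  have : b ∈ C.1.commutant.commutant := by
    rw [VonNeumannAlgebra.mem_commutant_iff]
    intro y hy
    have hy' := star_mem hy
    rw [VonNeumannAlgebra.mem_commutant_iff] at hy hy'
    exact (h y (fun x hx => hy x hx) (fun x hx => hy' x hx)).symm.eq
  rwa [VonNeumannAlgebra.commutant_commutant] at this

theorem Context.commute (C : Context A) {x y : H →L[ℂ] H} (hx : x ∈ C.alg) (hy : y ∈ C.alg) :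
    Commute x y :=
  C.2.2 x hx y hy

theorem Context.cfc_mem (C : Context A) {x : H →L[ℂ] H} (hx : x ∈ C.alg) (f : ℝ → ℝ) :
    cfc f x ∈ C.alg :=
  C.mem_alg_of_commute fun _ h _ => (h x hx).cfc_real f

theorem Context.real_smul_mem (C : Context A) {x : H →L[ℂ] H} (hx : x ∈ C.alg) (r : ℝ) :
    r • x ∈ C.alg := by
  rw [← Complex.coe_smul]
  exact SMulMemClass.smul_mem _ hx

theorem Context.spectralProjection_mem (C : Context A) {b : H →L[ℂ] H} (hb : b ∈ C.alg)
    (Δ : Set ℝ) : spectralProjection b Δ ∈ C.alg :=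
  C.mem_alg_of_commute fun _ h h' => commute_spectralProjection (h b hb) (h' b hb) Δ

/-- The projections of a context form a complete lattice, and infima remain infima among all
projections. -/
theorem Context.exists_isGLB_proj (C : Context A) (S : Set C.Proj) :
    ∃ q, IsGLB S q ∧ ∀ p : H →L[ℂ] H, IsStarProjection p → (∀ q ∈ S, p ≤ q.1) → p ≤ q.1 := by
  -- The infimum projects onto the intersection of the ranges, which the commutant of `C` leaves
  -- invariant.
  let U : Submodule ℂ H := ⨅ q ∈ S, LinearMap.eqLocus (q.1 : H →ₗ[ℂ] H) LinearMap.id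
  have hU : ∀ v, v ∈ U ↔ ∀ q ∈ S, q.1 v = v := by
    intro v
    simp only [U, Submodule.mem_iInf, LinearMap.mem_eqLocus]
    rfl
  have hUc : IsClosed (U : Set H) := by
    have : (U : Set H) = ⋂ q ∈ S, {v | q.1 v = v} := by
      ext v
      simp only [SetLike.mem_coe, hU, mem_iInter, mem_ofPred_eq]
    rw [this]
    exact isClosed_biInter fun q _ => isClosed_eq q.1.continuous continuous_id
  have : CompleteSpace U := hUc.completeSpace_coe
  have hinv : ∀ y : H →L[ℂ] H, (∀ x ∈ C.alg, Commute x y) → ∀ v ∈ U, y v ∈ U := by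
    intro y hy v hv
    rw [hU] at hv ⊢
    intro q hq
    have h := DFunLike.congr_fun (hy q.1 q.2.1).eq v
    rwa [mul_apply_eq_comp, mul_apply_eq_comp, hv q hq] at h
  have hle : ∀ p : H →L[ℂ] H, IsStarProjection p → (∀ q ∈ S, p ≤ q.1) → p ≤ U.starProjection :=
    fun p hp h => (le_starProjection_iff hp).2 fun v hv => (hU v).2 fun q hq =>
      apply_eq_self_of_le hp q.2.2 (h q hq) hv
  exact ⟨⟨U.starProjection, C.mem_alg_of_commute fun y h h' =>
    commute_starProjection (hinv y h) (hinv _ h'), isStarProjection_starProjection⟩,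
    ⟨fun q hq => (starProjection_le_iff q.2.2).2 fun v hv => (hU v).1 hv q hq,
      fun p hp => hle p.1 p.2.2 fun q hq => hp hq⟩, hle⟩

/-- Two self-adjoint elements of a context have a supremum, even among all self-adjoint operators
that commute with the context. -/
theorem Context.exists_sup (C : Context A) (x y : C.SelfAdj) :
    ∃ z : C.SelfAdj, x ≤ z ∧ y ≤ z ∧ ∀ c : H →L[ℂ] H, (∀ u ∈ C.alg, Commute c u) →
      x.1 ≤ c → y.1 ≤ c → z.1 ≤ c := by
  have hd : IsSelfAdjoint (x.1 - y.1) := x.2.2.sub y.2.2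
  set m : H →L[ℂ] H := cfc (fun t : ℝ => |t|) (x.1 - y.1) with hm
  have hmsa : IsSelfAdjoint m := cfc_predicate _ _
  have h1 : x.1 - y.1 ≤ m := by
    conv_lhs => rw [← cfc_id' ℝ (x.1 - y.1)]
    exact cfc_mono fun t _ => le_abs_self t
  have h2 : y.1 - x.1 ≤ m := by
    have : y.1 - x.1 = cfc (fun t : ℝ => -t) (x.1 - y.1) := by
      rw [cfc_neg (fun t : ℝ => t), cfc_id' ℝ (x.1 - y.1), neg_sub]
    rw [this]
    exact cfc_mono fun t _ => neg_le_abs t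
  have two : ∀ u w : H →L[ℂ] H, (2 : ℝ) • u ≤ (2 : ℝ) • w → u ≤ w := fun u w h => by
    have := smul_le_smul_of_nonneg_left h (show (0 : ℝ) ≤ 1 / 2 by norm_num)
    rwa [smul_smul, smul_smul, show (1 / 2 : ℝ) * 2 = 1 by norm_num, one_smul, one_smul] at this
  -- As for real numbers, the maximum is `(x + y + |x - y|) / 2`.
  refine ⟨⟨(1 / 2 : ℝ) • (x.1 + y.1 + m), C.real_smul_mem (add_mem (add_mem x.2.1 y.2.1)
    (C.cfc_mem (sub_mem x.2.1 y.2.1) _)) _,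
    .smul (.all _) ((x.2.2.add y.2.2).add hmsa)⟩, ?_, ?_, ?_⟩
  · refine two _ _ ?_
    rw [smul_smul, show (2 : ℝ) * (1 / 2) = 1 by norm_num, one_smul, ← sub_nonneg]
    convert sub_nonneg.2 h1 using 1
    module
  · refine two _ _ ?_
    rw [smul_smul, show (2 : ℝ) * (1 / 2) = 1 by norm_num, one_smul, ← sub_nonneg]
    convert sub_nonneg.2 h2 using 1
    module
  · intro c hcomm hcx hcy
    -- Here `x - y = (c - y) - (c - x)` is a difference of commuting positive operators, so `|x - y|
    -- ≤ (c - y) + (c - x)`.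
    have h := cfc_abs_sub_le_add (sub_nonneg.2 hcy) (sub_nonneg.2 hcx)
      (((Commute.refl c).sub_right (hcomm _ x.2.1)).sub_left
        ((hcomm _ y.2.1).symm.sub_right (C.commute y.2.1 x.2.1)))
    rw [sub_sub_sub_cancel_left] at h
    refine two _ _ ?_
    rw [smul_smul, show (2 : ℝ) * (1 / 2) = 1 by norm_num, one_smul, ← sub_nonneg]
    convert sub_nonneg.2 h using 1
    module

/-- The self-adjoint part of a context is conditionally complete, and suprema remain suprema among
all self-adjoint operators that commute with the context. -/
theorem Context.exists_isLUB_selfAdj (C : Context A) {S : Set C.SelfAdj} (hS : S.Nonempty)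
    (hb : BddAbove S) : ∃ d, IsLUB S d ∧ ∀ c : H →L[ℂ] H, IsSelfAdjoint c →
      (∀ u ∈ C.alg, Commute c u) → (∀ b ∈ S, b.1 ≤ c) → d.1 ≤ c := by
  choose sup hle_left hle_right hsup using C.exists_sup
  let : SemilatticeSup C.SelfAdj :=
    { (inferInstance : PartialOrder C.SelfAdj) with
      sup := sup
      le_sup_left := hle_left
      le_sup_right := hle_right
      sup_le := fun x y z hx hy => hsup x y z.1 (fun u hu => C.commute z.2.1 hu) hx hy }
  obtain ⟨M, hM⟩ := hb
  have hM' : M ∈ upperBounds (supClosure S) := by rwa [upperBounds_supClosure]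
  -- Closing `S` under binary suprema keeps its upper bounds and makes it directed, hence a monotone
  -- net indexed by itself.
  have hne : Nonempty (supClosure S) := (hS.mono subset_supClosure).to_subtype
  have hdir : IsDirectedOrder (supClosure S) :=
    ⟨fun x y => ⟨⟨x.1 ⊔ y.1, supClosed_supClosure x.2 y.2⟩, le_sup_left (a := x.1),
      le_sup_right (b := y.1)⟩⟩
  obtain ⟨d, hd⟩ := exists_tendsto_inner_of_monotone (ι := supClosure S) (b := fun i => i.1.1)
    (fun i j hij => hij) (fun i => i.1.2.2) (M := M.1) (fun i => hM' i.2)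
  have hdsa : IsSelfAdjoint d := isSelfAdjoint_of_inner fun v w => by
    refine tendsto_nhds_unique (hd v w) ?_
    have := (Complex.continuous_conj.tendsto _).comp (hd w v)
    rw [inner_conj_symm] at this
    refine this.congr fun i => ?_
    rw [Function.comp_apply, inner_conj_symm, inner_apply_of_isSelfAdjoint i.1.2.2]
  have hdC : d ∈ C.alg := C.mem_alg_of_commute fun y hy _ => by
    ext v
    refine ext_inner_right ℂ fun w => tendsto_nhds_unique (hd (y v) w) ?_
    rw [mul_apply_eq_comp, ← ContinuousLinearMap.adjoint_inner_right]
    refine (hd v _).congr fun i => ?_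
    rw [ContinuousLinearMap.adjoint_inner_right]
    have := DFunLike.congr_fun (hy i.1.1 i.1.2.1).eq v
    rw [mul_apply_eq_comp, mul_apply_eq_comp] at this
    rw [this]
  have hre : ∀ v, Tendsto (fun i : supClosure S => i.1.1.reApplyInnerSelf v) atTop
      (𝓝 (d.reApplyInnerSelf v)) := fun v => (Complex.continuous_re.tendsto _).comp (hd v v)
  have hle : ∀ c : H →L[ℂ] H, IsSelfAdjoint c → (∀ u ∈ C.alg, Commute c u) →
      (∀ b ∈ S, b.1 ≤ c) → d ≤ c := by
    intro c hc hcomm hSc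
    -- Bounds outside `C` pass to binary suprema only because `c` commutes with `C`.
    have hcl : supClosure S ⊆ {b | b.1 ≤ c} :=
      supClosure_min hSc fun x hx y hy => hsup x y c hcomm hx hy
    refine le_of_reApplyInnerSelf_le hdsa hc fun v => ?_
    exact le_of_tendsto' (hre v) fun j => reApplyInnerSelf_mono (hcl j.2) v
  refine ⟨⟨d, hdC, hdsa⟩, ⟨fun i hi => ?_, fun c hc => ?_⟩, hle⟩
  · refine le_of_reApplyInnerSelf_le i.2.2 hdsa fun v => ?_
    exact ge_of_tendsto (hre v) ((eventually_ge_atTop (⟨i, subset_supClosure hi⟩ :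
      supClosure S)).mono fun j hj => reApplyInnerSelf_mono (show i.1 ≤ j.1.1 from hj) v)
  · exact hle c.1 c.2.2 (fun u hu => C.commute c.2.1 hu) fun b hb => hc hb

theorem Context.exists_isGLB_selfAdj (C : Context A) {S : Set C.SelfAdj} (hS : S.Nonempty)
    (hb : BddBelow S) : ∃ d, IsGLB S d ∧ ∀ c : H →L[ℂ] H, IsSelfAdjoint c →
      (∀ u ∈ C.alg, Commute c u) → (∀ b ∈ S, c ≤ b.1) → c ≤ d.1 := by
  let N : C.SelfAdj → C.SelfAdj := fun b => ⟨-b.1, neg_mem b.2.1, b.2.2.neg⟩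
  have hN : ∀ b c, b ≤ c → N c ≤ N b := fun b c h => neg_le_neg (show b.1 ≤ c.1 from h)
  obtain ⟨M, hM⟩ := hb
  obtain ⟨d, hd, hd'⟩ := C.exists_isLUB_selfAdj (hS.image N)
    ⟨N M, by rintro _ ⟨b, hb, rfl⟩; exact hN _ _ (hM hb)⟩
  refine ⟨N d, ⟨fun b hb => ?_, fun c hc => ?_⟩, fun c hc hcomm hcS => ?_⟩
  · exact neg_le.1 (show -b.1 ≤ d.1 from hd.1 (mem_image_of_mem N hb))
  · refine le_neg.1 (show d.1 ≤ -c.1 from hd.2 (?_ : N c ∈ _))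
    rintro _ ⟨b, hb, rfl⟩
    exact hN _ _ (hc hb)
  · refine le_neg.1 (hd' (-c) hc.neg (fun u hu => (hcomm u hu).neg_left) ?_)
    rintro _ ⟨b, hb, rfl⟩
    exact neg_le_neg (hcS b hb)

theorem Context.isLUB_le_of_commute {C : Context A} {S : Set C.SelfAdj} (hS : S.Nonempty)
    {d : C.SelfAdj} (hd : IsLUB S d) {c : H →L[ℂ] H} (hc : IsSelfAdjoint c)
    (hcomm : ∀ u ∈ C.alg, Commute c u) (h : ∀ b ∈ S, b.1 ≤ c) : d.1 ≤ c := by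
  obtain ⟨e, he, he'⟩ := C.exists_isLUB_selfAdj hS ⟨d, hd.1⟩
  rw [hd.unique he]
  exact he' c hc hcomm h

theorem Context.le_isGLB_of_commute {C : Context A} {S : Set C.SelfAdj} (hS : S.Nonempty)
    {d : C.SelfAdj} (hd : IsGLB S d) {c : H →L[ℂ] H} (hc : IsSelfAdjoint c)
    (hcomm : ∀ u ∈ C.alg, Commute c u) (h : ∀ b ∈ S, c ≤ b.1) : c ≤ d.1 := by
  obtain ⟨e, he, he'⟩ := C.exists_isGLB_selfAdj hS ⟨d, hd.1⟩
  rw [hd.unique he]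
  exact he' c hc hcomm h

end Contexts

/-! ### Two-valued operators and the spectral order -/

section SpectralOrder

variable {H : Type*} [NormedAddCommGroup H] [InnerProductSpace ℂ H] {a b q : H →L[ℂ] H}

local notation "⟪" x ", " y "⟫" => inner ℂ x y

theorem twoValued_apply_of_apply_eq_self {v : H} (hv : q v = v) (r m : ℝ) :
    (r • q + m • (1 - q)) v = r • v := by
  simp [hv]

theorem twoValued_apply_of_apply_eq_zero {v : H} (hv : q v = 0) (r m : ℝ) :
    (r • q + m • (1 - q)) v = m • v := by
  simp [hv]

theorem reApplyInnerSelf_real_smul_of_apply {c : H →L[ℂ] H} {r : ℝ} {v : H} (h : c v = r • v) :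
    c.reApplyInnerSelf v = r * ‖v‖ ^ 2 := by
  rw [← reApplyInnerSelf_one, ← reApplyInnerSelf_real_smul,
    ContinuousLinearMap.reApplyInnerSelf_apply, ContinuousLinearMap.reApplyInnerSelf_apply, h]
  rfl

variable [CompleteSpace H]

theorem isSelfAdjoint_twoValued (hq : IsStarProjection q) (r m : ℝ) :
    IsSelfAdjoint (r • q + m • (1 - q)) :=
  (IsSelfAdjoint.smul (.all r) hq.isSelfAdjoint).add
    (IsSelfAdjoint.smul (.all m) ((IsSelfAdjoint.one _).sub hq.isSelfAdjoint))

theorem apply_self_sub (hq : IsStarProjection q) (v : H) : q (v - q v) = 0 := by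
  have h : q (q v) = q v := DFunLike.congr_fun hq.isIdempotentElem v
  rw [map_sub, h, sub_self]

theorem mem_spectralSubspace_of_apply_eq_smul (hb : IsSelfAdjoint b) {m x : ℝ} {v : H}
    (hv : b v = m • v) (hm : m ≤ x) : v ∈ spectralSubspace b (Iic x) :=
  spectrallySupported_subset_spectralSubspace b isClosed_Iic Subset.rfl fun f hf h0 => by
    rw [cfc_apply_eq_smul hb hf hv, h0 m hm, zero_smul]

theorem twoValued_spectralLE (ha : IsSelfAdjoint a) (hq : IsStarProjection q) {m r : ℝ}
    (hm : m ≤ -‖a‖)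
    (h : ∀ x < r, ∀ v ∈ spectralSubspace a (Iic x), q v = v) :
    SpectralLE (m • q + r • (1 - q)) a := by
  have hb := isSelfAdjoint_twoValued hq m r
  refine spectralLE_iff.2 fun x v hv => ?_
  rcases lt_or_ge x m with hx | hx
  · rw [spectralSubspace_Iic_eq_bot ha (hx.trans_le hm), Submodule.mem_bot] at hv
    rw [hv]
    exact zero_mem _
  rcases lt_or_ge x r with hx' | hx'
  · exact mem_spectralSubspace_of_apply_eq_smul hb
      (twoValued_apply_of_apply_eq_self (h x hx' v hv) _ _) hx
  · rw [← add_sub_cancel (q v) v]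
    refine add_mem (mem_spectralSubspace_of_apply_eq_smul hb
      (twoValued_apply_of_apply_eq_self ?_ _ _) hx) (mem_spectralSubspace_of_apply_eq_smul hb
      (twoValued_apply_of_apply_eq_zero (apply_self_sub hq v) _ _) hx')
    exact DFunLike.congr_fun hq.isIdempotentElem v

theorem spectralLE_twoValued (ha : IsSelfAdjoint a) (hq : IsStarProjection q) {M s : ℝ}
    (hM : ‖a‖ ≤ M) (h : ∀ v, q v = 0 → v ∈ spectralSubspace a (Iic s)) :
    SpectralLE a (M • q + s • (1 - q)) := by
  have hb := isSelfAdjoint_twoValued hq M s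
  refine spectralLE_iff.2 fun x v hv => ?_
  rcases le_or_gt M x with hx | hx
  · rw [spectralSubspace_Iic_eq_top ha (hM.trans hx)]
    trivial
  rw [← SetLike.mem_coe, spectralSubspace_coe_eq_of_isClosed _ isClosed_Iic] at hv
  have hf : Continuous fun t : ℝ => max (t - x) 0 := by fun_prop
  have hfv := hv _ hf fun t ht => max_eq_right (by simpa using ht)
  have hqq : q (q v) = q v := DFunLike.congr_fun hq.isIdempotentElem v
  have hcomm : Commute (M • q + s • (1 - q)) q :=
    ((Commute.refl q).smul_left M).add_left
      (((Commute.one_left q).sub_left (Commute.refl q)).smul_left s)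
  -- The function is positive at `M > x`, so the `q`-component of `v`, an eigenvector for `M`, must
  -- vanish.
  have hqv : q v = 0 := by
    have h1 := DFunLike.congr_fun (hcomm.cfc_real fun t : ℝ => max (t - x) 0).eq v
    rw [mul_apply_eq_comp, mul_apply_eq_comp, hfv, map_zero,
      cfc_apply_eq_smul hb hf (twoValued_apply_of_apply_eq_self hqq _ _)] at h1
    refine (smul_eq_zero.1 h1).resolve_left (ne_of_gt ?_)
    exact lt_max_of_lt_left (sub_pos.2 hx)
  rcases le_or_gt s x with hsx | hsx
  · exact spectralSubspace_mono a (Iic_subset_Iic.2 hsx) (h v hqv)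
  · rw [cfc_apply_eq_smul hb hf (twoValued_apply_of_apply_eq_zero hqv _ _)] at hfv
    rw [(smul_eq_zero.1 hfv).resolve_left (ne_of_gt (lt_max_of_lt_left (sub_pos.2 hsx)))]
    exact zero_mem _

theorem reApplyInnerSelf_le_of_spectralLE (ha : IsSelfAdjoint a) (hb : IsSelfAdjoint b)
    (h : SpectralLE b a) (v : H) : b.reApplyInnerSelf v ≤ ‖a‖ * ‖v‖ ^ 2 := by
  refine reApplyInnerSelf_le_of_mem hb (spectralLE_iff.1 h ‖a‖ ?_)
  rw [spectralSubspace_Iic_eq_top ha le_rfl]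
  trivial

theorem mem_spectralSubspace_Ici_of_mem_orthogonal {x : ℝ} {v : H}
    (hv : v ∈ (spectralSubspace b (Iic x))ᗮ) : v ∈ spectralSubspace b (Ici x) := by
  rw [← compl_Iio]
  exact mem_spectralSubspace_compl b isOpen_Iio
    (Submodule.orthogonal_le (spectralSubspace_mono b Iio_subset_Iic_self) hv)

theorem le_reApplyInnerSelf_of_spectralLE (ha : IsSelfAdjoint a) (hb : IsSelfAdjoint b)
    (h : SpectralLE a b) (v : H) : (-‖a‖ - 1) * ‖v‖ ^ 2 ≤ b.reApplyInnerSelf v := by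
  refine le_reApplyInnerSelf_of_mem hb (mem_spectralSubspace_Ici_of_mem_orthogonal ?_)
  have h1 := spectralLE_iff.1 h (-‖a‖ - 1)
  rw [spectralSubspace_Iic_eq_bot ha (by linarith), le_bot_iff] at h1
  rw [h1, Submodule.bot_orthogonal_eq_top]
  trivial

/-- An operator commuting with `q` is block diagonal, so order bounds can be checked separately on
the range and the kernel of `q`. -/
theorem reApplyInnerSelf_split (hq : IsStarProjection q) (h : Commute b q) (v : H) :
    b.reApplyInnerSelf v = b.reApplyInnerSelf (q v) + b.reApplyInnerSelf (v - q v) := by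
  have hqq : q (q v) = q v := DFunLike.congr_fun hq.isIdempotentElem v
  have hb : ∀ w, b (q w) = q (b w) := fun w => DFunLike.congr_fun h.eq w
  have h1 : ⟪b (q v), v - q v⟫ = 0 := by
    rw [hb, inner_apply_of_isSelfAdjoint hq.isSelfAdjoint, apply_self_sub hq, inner_zero_right]
  have h2 : ⟪b (v - q v), q v⟫ = 0 := by
    rw [← inner_apply_of_isSelfAdjoint hq.isSelfAdjoint, ← hb, apply_self_sub hq, map_zero,
      inner_zero_left]
  have h3 : ⟪b v, v⟫ = ⟪b (q v), q v⟫ + ⟪b (v - q v), v - q v⟫ := by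
    conv_lhs => rw [← add_sub_cancel (q v) v]
    rw [map_add, inner_add_left, inner_add_right, inner_add_right, h1, h2]
    ring
  simp only [ContinuousLinearMap.reApplyInnerSelf_apply, h3, map_add]

theorem reApplyInnerSelf_twoValued (hq : IsStarProjection q) (r m : ℝ) (v : H) :
    (r • q + m • (1 - q)).reApplyInnerSelf v = r * ‖q v‖ ^ 2 + m * ‖v - q v‖ ^ 2 := by
  have hcomm : Commute (r • q + m • (1 - q)) q :=
    ((Commute.refl q).smul_left r).add_left
      (((Commute.one_left q).sub_left (Commute.refl q)).smul_left m)
  rw [reApplyInnerSelf_split hq hcomm]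
  congr 1
  · exact reApplyInnerSelf_real_smul_of_apply
      (twoValued_apply_of_apply_eq_self (DFunLike.congr_fun hq.isIdempotentElem v) _ _)
  · exact reApplyInnerSelf_real_smul_of_apply
      (twoValued_apply_of_apply_eq_zero (apply_self_sub hq v) _ _)

theorem le_twoValued_of_spectralLE (ha : IsSelfAdjoint a) (hb : IsSelfAdjoint b)
    (h : SpectralLE b a) (hq : IsStarProjection q) (hbq : Commute b q) {r : ℝ}
    (hr : ∀ v, q v = v → v ∈ spectralSubspace b (Iic r)) : b ≤ r • q + ‖a‖ • (1 - q) := by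
  refine le_of_reApplyInnerSelf_le hb (isSelfAdjoint_twoValued hq _ _) fun v => ?_
  rw [reApplyInnerSelf_split hq hbq, reApplyInnerSelf_twoValued hq]
  exact add_le_add (reApplyInnerSelf_le_of_mem hb
    (hr _ (DFunLike.congr_fun hq.isIdempotentElem v))) (reApplyInnerSelf_le_of_spectralLE ha hb h _)

theorem twoValued_le_of_spectralLE (ha : IsSelfAdjoint a) (hb : IsSelfAdjoint b)
    (h : SpectralLE a b) (hq : IsStarProjection q) (hbq : Commute b q) {s : ℝ}
    (hs : ∀ v, q v = v → v ∈ (spectralSubspace b (Iic s))ᗮ) :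
    s • q + (-‖a‖ - 1) • (1 - q) ≤ b := by
  refine le_of_reApplyInnerSelf_le (isSelfAdjoint_twoValued hq _ _) hb fun v => ?_
  rw [reApplyInnerSelf_split hq hbq, reApplyInnerSelf_twoValued hq]
  exact add_le_add (le_reApplyInnerSelf_of_mem hb (mem_spectralSubspace_Ici_of_mem_orthogonal
    (hs _ (DFunLike.congr_fun hq.isIdempotentElem v)))) (le_reApplyInnerSelf_of_spectralLE ha hb h _)

end SpectralOrder

/-! ### Daseinisation, characters and the two inclusions -/

section Daseinisation

variable {H : Type*} [NormedAddCommGroup H] [InnerProductSpace ℂ H] [CompleteSpace H]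
  {A : VonNeumannAlgebra H} {a : H →L[ℂ] H}

/-- The operator with value `r` on the range of `q` and `m` on its kernel, in a context. -/
def Context.twoValued {C : Context A} (q : C.Proj) (r m : ℝ) : C.SelfAdj :=
  ⟨r • q.1 + m • (1 - q.1), add_mem (C.real_smul_mem q.2.1 r)
    (C.real_smul_mem (sub_mem (one_mem _) q.2.1) m), isSelfAdjoint_twoValued q.2.2 r m⟩

theorem isGLB_outerDasProj (p : H →L[ℂ] H) (C : Context A) :
    IsGLB (projAbove p C) (outerDasProj p C) :=
  Classical.epsilon_spec ((C.exists_isGLB_proj (projAbove p C)).imp fun _ h => h.1)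

theorem le_outerDasProj {p : H →L[ℂ] H} (hp : IsStarProjection p) (C : Context A) :
    p ≤ (outerDasProj p C).1 := by
  obtain ⟨q, hq, hq'⟩ := C.exists_isGLB_proj (projAbove p C)
  rw [(isGLB_outerDasProj p C).unique hq]
  exact hq' p hp fun _ h => h

theorem spectrallyAbove_nonempty (ha : IsSelfAdjoint a) (C : Context A) :
    (spectrallyAbove a C).Nonempty := by
  -- With `q = 1` this is the scalar `‖a‖`; the second value plays no role.
  refine ⟨Context.twoValued ⟨1, one_mem _, .one _⟩ ‖a‖ 0,
    spectralLE_twoValued ha (.one _) le_rfl fun v hv => ?_⟩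
  rw [one_apply_eq_self] at hv
  rw [hv]
  exact zero_mem _

theorem spectrallyBelow_nonempty (ha : IsSelfAdjoint a) (C : Context A) :
    (spectrallyBelow a C).Nonempty :=
  ⟨Context.twoValued ⟨1, one_mem _, .one _⟩ (-‖a‖) (-‖a‖), twoValued_spectralLE ha (.one _) le_rfl
    fun _ _ v _ => one_apply_eq_self v⟩

theorem isGLB_outerDas (ha : IsSelfAdjoint a) (C : Context A) :
    IsGLB (spectrallyAbove a C) (outerDas a C) := by
  refine Classical.epsilon_spec ((C.exists_isGLB_selfAdj (spectrallyAbove_nonempty ha C)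
    ⟨Context.twoValued ⟨1, one_mem _, .one _⟩ (-‖a‖ - 1) 0, fun b hb => ?_⟩).imp fun _ h => h.1)
  refine le_of_reApplyInnerSelf_le (isSelfAdjoint_twoValued (.one _) _ _) b.2.2 fun v => ?_
  refine (reApplyInnerSelf_twoValued (.one _) _ _ v).trans_le ?_
  simpa using le_reApplyInnerSelf_of_spectralLE ha b.2.2 hb v

theorem isLUB_innerDas (ha : IsSelfAdjoint a) (C : Context A) :
    IsLUB (spectrallyBelow a C) (innerDas a C) := by
  refine Classical.epsilon_spec ((C.exists_isLUB_selfAdj (spectrallyBelow_nonempty ha C)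
    ⟨Context.twoValued ⟨1, one_mem _, .one _⟩ ‖a‖ 0, fun b hb => ?_⟩).imp fun _ h => h.1)
  refine le_of_reApplyInnerSelf_le b.2.2 (isSelfAdjoint_twoValued (.one _) _ _) fun v => ?_
  refine le_of_le_of_eq ?_ (reApplyInnerSelf_twoValued (.one _) _ _ v).symm
  simpa using reApplyInnerSelf_le_of_spectralLE ha b.2.2 hb v

/-- Elements of `D` spectrally above `a` are also candidates in `C`, so `δᵒ(a)_C` bounds them from
below; it lies outside `D` in general but commutes with `D`. -/
theorem outerDas_anti (ha : IsSelfAdjoint a) {C D : Context A} (h : D ≤ C) :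
    (outerDas a C).1 ≤ (outerDas a D).1 :=
  Context.le_isGLB_of_commute (spectrallyAbove_nonempty ha D) (isGLB_outerDas ha D)
    (outerDas a C).2.2 (fun _ hu => C.commute (outerDas a C).2.1 (h hu)) fun b hb =>
      (isGLB_outerDas ha C).1 (show (⟨b.1, h b.2.1, b.2.2⟩ : C.SelfAdj) ∈ spectrallyAbove a C from hb)

theorem innerDas_mono (ha : IsSelfAdjoint a) {C D : Context A} (h : D ≤ C) :
    (innerDas a D).1 ≤ (innerDas a C).1 :=
  Context.isLUB_le_of_commute (spectrallyBelow_nonempty ha D) (isLUB_innerDas ha D)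
    (innerDas a C).2.2 (fun _ hu => C.commute (innerDas a C).2.1 (h hu)) fun b hb =>
      (isLUB_innerDas ha C).1 (show (⟨b.1, h b.2.1, b.2.2⟩ : C.SelfAdj) ∈ spectrallyBelow a C from hb)

theorem re_character_nonneg {C : Context A} (l : C.Spectrum) {x : C.alg} (hx : 0 ≤ x.1) :
    0 ≤ (l x).re := by
  have hcl : IsClosed (C.alg : Set (H →L[ℂ] H)) :=
    (completeSpace_coe_iff_isComplete.1 (inferInstanceAs (CompleteSpace C.alg))).isClosed
  -- Spectral permanence: the spectrum in the closed subalgebra agrees with that among all bounded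
  -- operators.
  have h1 : l x ∈ spectrum ℂ x.1 :=
    (StarSubalgebra.mem_spectrum_iff C.alg).1 (AlgHom.apply_mem_spectrum l x)
  rw [(IsSelfAdjoint.of_nonneg hx).mem_spectrum_eq_re h1] at h1
  exact spectrum_nonneg_of_nonneg hx (spectrum.algebraMap_mem_iff ℂ |>.1 h1)

theorem pairing_mono {C : Context A} (l : C.Spectrum) {x y : C.SelfAdj} (h : x ≤ y) :
    pairing l x ≤ pairing l y := by
  have h0 : 0 ≤ y.1 - x.1 := sub_nonneg.2 h
  have h1 := re_character_nonneg l (x := ⟨y.1, y.2.1⟩ - ⟨x.1, x.2.1⟩) h0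
  rw [map_sub, Complex.sub_re] at h1
  exact sub_nonneg.1 h1

theorem character_proj {C : Context A} (l : C.Spectrum) (q : C.Proj) :
    l (⟨q.1, q.2.1⟩ : C.alg) = 0 ∨ l (⟨q.1, q.2.1⟩ : C.alg) = 1 := by
  have h : (⟨q.1, q.2.1⟩ : C.alg) * ⟨q.1, q.2.1⟩ = ⟨q.1, q.2.1⟩ :=
    Subtype.ext q.2.2.isIdempotentElem
  have h1 := congrArg l h
  rw [map_mul] at h1
  exact IsIdempotentElem.iff_eq_zero_or_one.1 h1

theorem pairing_twoValued {C : Context A} (l : C.Spectrum) (q : C.Proj) (r m : ℝ) :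
    pairing l (Context.twoValued q r m) =
      r * (l (⟨q.1, q.2.1⟩ : C.alg)).re + m * (1 - (l (⟨q.1, q.2.1⟩ : C.alg)).re) := by
  have h : (⟨(Context.twoValued q r m).1, (Context.twoValued q r m).2.1⟩ : C.alg) =
      (r : ℂ) • (⟨q.1, q.2.1⟩ : C.alg) + (m : ℂ) • (1 - (⟨q.1, q.2.1⟩ : C.alg)) := by
    refine Subtype.ext ?_
    simp only [Context.twoValued, ← Complex.coe_smul]
    rfl
  rw [pairing, h, map_add, map_smul, map_smul, map_sub, map_one]
  simp

theorem isOpen_iff_stateSpace {U : Set (StateSpace A)} : IsOpen U ↔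
    (∀ (C D : Context A) (h : D ≤ C) (l : C.Spectrum),
      (⟨C, l⟩ : StateSpace A) ∈ U → (⟨D, Context.restrict h l⟩ : StateSpace A) ∈ U) ∧
    ∀ C : Context A, IsOpen {l : C.Spectrum | (⟨C, l⟩ : StateSpace A) ∈ U} :=
  Iff.rfl

theorem continuous_pairing {C : Context A} (b : C.SelfAdj) :
    Continuous fun l : C.Spectrum => pairing l b :=
  Complex.continuous_re.comp
    ((WeakDual.eval_continuous (⟨b.1, b.2.1⟩ : C.alg)).comp continuous_subtype_val)

theorem pairing_restrict_innerDas_le (ha : IsSelfAdjoint a) {C D : Context A} (h : D ≤ C)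
    (l : C.Spectrum) :
    pairing (Context.restrict h l) (innerDas a D) ≤ pairing l (innerDas a C) :=
  pairing_mono l (x := ⟨(innerDas a D).1, h (innerDas a D).2.1, (innerDas a D).2.2⟩)
    (innerDas_mono ha h)

theorem le_pairing_restrict_outerDas (ha : IsSelfAdjoint a) {C D : Context A} (h : D ≤ C)
    (l : C.Spectrum) :
    pairing l (outerDas a C) ≤ pairing (Context.restrict h l) (outerDas a D) :=
  pairing_mono l (y := ⟨(outerDas a D).1, h (outerDas a D).2.1, (outerDas a D).2.2⟩)
    (outerDas_anti ha h)

/-- Each preimage is checked on subbasic sets: monotonicity of daseinisation gives stability under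
restriction, and weak-* continuity of evaluation gives openness in each fibre. -/
theorem continuous_das (ha : IsSelfAdjoint a) : Continuous (das A a) := by
  refine Continuous.prodMk ?_ (Continuous.prodMk ?_ ?_)
  · refine continuous_def.2 fun U hU => isOpen_iff_stateSpace.2 ⟨fun C D h l hl => ?_, fun C => ?_⟩
    · exact Topology.IsLowerSet.isOpen_iff_isLowerSet.1 hU h hl
    · exact isOpen_const (p := Topology.WithLowerSet.toLowerSet C ∈ U)
  · refine continuous_generateFrom_iff.2 ?_
    rintro _ ⟨y, rfl⟩
    refine isOpen_iff_stateSpace.2 ⟨fun C D h l hl => ?_, fun C => ?_⟩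
    · refine fun hy => hl (mem_Ici.2 (le_trans (mem_Ici.1 hy) ?_))
      exact EReal.coe_le_coe_iff.2 (pairing_restrict_innerDas_le ha h l)
    · have : Continuous fun l : C.Spectrum => ((pairing l (innerDas a C) : ℝ) : EReal) :=
        continuous_coe_real_ereal.comp (continuous_pairing _)
      exact ((isClosed_Ici (a := Topology.WithLower.ofLower y)).preimage this).isOpen_compl
  · refine continuous_generateFrom_iff.2 ?_
    rintro _ ⟨y, rfl⟩
    refine isOpen_iff_stateSpace.2 ⟨fun C D h l hl => ?_, fun C => ?_⟩
    · refine fun hy => hl (mem_Iic.2 (le_trans ?_ (mem_Iic.1 hy)))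
      exact EReal.coe_le_coe_iff.2 (le_pairing_restrict_outerDas ha h l)
    · have : Continuous fun l : C.Spectrum => ((pairing l (outerDas a C) : ℝ) : EReal) :=
        continuous_coe_real_ereal.comp (continuous_pairing _)
      exact ((isClosed_Iic (a := Topology.WithUpper.ofUpper y)).preimage this).isOpen_compl

theorem mem_elementaryProp_Iio_of_pairing_lt (ha : IsSelfAdjoint a) {r : ℝ} {x : StateSpace A}
    (h : pairing x.2 (innerDas a x.1) < r) : x ∈ elementaryProp A a (Iio r) := by
  set q := outerDasProj (spectralProjection a (Iio r)) x.1 with hq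
  refine (character_proj x.2 q).resolve_left fun h0 => h.not_ge ?_
  have hle := le_outerDasProj (isStarProjection_spectralProjection a (Iio r)) x.1
  have hb : Context.twoValued q (-‖a‖) r ∈ spectrallyBelow a x.1 :=
    twoValued_spectralLE ha q.2.2 le_rfl fun y hy v hv =>
      (spectralProjection_le_iff q.2.2).1 hle v
        (spectralSubspace_mono a (Iic_subset_Iio.2 hy) hv)
  have h1 := pairing_mono x.2 ((isLUB_innerDas ha x.1).1 hb)
  rwa [pairing_twoValued, h0, Complex.zero_re, mul_zero, sub_zero, mul_one, zero_add] at h1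

theorem mem_elementaryProp_Ioi_of_lt_pairing (ha : IsSelfAdjoint a) {s : ℝ} {x : StateSpace A}
    (h : s < pairing x.2 (outerDas a x.1)) : x ∈ elementaryProp A a (Ioi s) := by
  set q := outerDasProj (spectralProjection a (Ioi s)) x.1 with hq
  refine (character_proj x.2 q).resolve_left fun h0 => h.not_ge ?_
  have hle := le_outerDasProj (isStarProjection_spectralProjection a (Ioi s)) x.1
  have hb : Context.twoValued q ‖a‖ s ∈ spectrallyAbove a x.1 := by
    refine spectralLE_twoValued ha q.2.2 le_rfl fun v hv => ?_
    rw [← compl_Ioi]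
    refine mem_spectralSubspace_compl a isOpen_Ioi ((Submodule.mem_orthogonal _ _).2 fun w hw => ?_)
    -- The range of `q` contains `w`, while `v` lies in the kernel of `q`.
    rw [← (spectralProjection_le_iff q.2.2).1 hle w hw,
      inner_apply_of_isSelfAdjoint q.2.2.isSelfAdjoint, hv, inner_zero_right]
  have h1 := pairing_mono x.2 ((isGLB_outerDas ha x.1).1 hb)
  rwa [pairing_twoValued, h0, Complex.zero_re, mul_zero, sub_zero, mul_one, zero_add] at h1

theorem pairing_innerDas_le_of_mem (ha : IsSelfAdjoint a) {r : ℝ} {x : StateSpace A}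
    (h : x ∈ elementaryProp A a (Iio r)) : pairing x.2 (innerDas a x.1) ≤ r := by
  set q := outerDasProj (spectralProjection a (Iio r)) x.1 with hq
  have h1 : x.2 (⟨q.1, q.2.1⟩ : x.1.alg) = 1 := h
  have hle : innerDas a x.1 ≤ Context.twoValued q r ‖a‖ := by
    refine (isLUB_innerDas ha x.1).2 fun b hb => ?_
    refine le_twoValued_of_spectralLE ha b.2.2 hb q.2.2 (x.1.commute b.2.1 q.2.1) fun v hv => ?_
    have he := isStarProjection_spectralProjection b.1 (Iic r)
    -- The projection `χ_{(-∞,r]}(b)` is one of those whose infimum is `q`.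
    have hmem : (⟨_, x.1.spectralProjection_mem b.2.1 (Iic r), he⟩ : x.1.Proj) ∈
        projAbove (spectralProjection a (Iio r)) x.1 :=
      (spectralProjection_le_iff he).2 fun w hw => spectralProjection_apply_eq_self_iff.2 <|
        spectralLE_iff.1 hb r (spectralSubspace_mono a Iio_subset_Iic_self hw)
    exact spectralProjection_apply_eq_self_iff.1
      (apply_eq_self_of_le q.2.2 he ((isGLB_outerDasProj _ x.1).1 hmem) hv)
  have h2 := pairing_mono x.2 hle
  rwa [pairing_twoValued, h1, Complex.one_re, mul_one, sub_self, mul_zero, add_zero] at h2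

theorem le_pairing_outerDas_of_mem (ha : IsSelfAdjoint a) {s : ℝ} {x : StateSpace A}
    (h : x ∈ elementaryProp A a (Ioi s)) : s ≤ pairing x.2 (outerDas a x.1) := by
  set q := outerDasProj (spectralProjection a (Ioi s)) x.1 with hq
  have h1 : x.2 (⟨q.1, q.2.1⟩ : x.1.alg) = 1 := h
  have hle : Context.twoValued q s (-‖a‖ - 1) ≤ outerDas a x.1 := by
    refine (isGLB_outerDas ha x.1).2 fun b hb => ?_
    refine twoValued_le_of_spectralLE ha b.2.2 hb q.2.2 (x.1.commute b.2.1 q.2.1) fun v hv => ?_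
    -- Here the competitor in the infimum is `1 - χ_{(-∞,s]}(b)`: the range of `χ_{(-∞,s]}(b)` lies
    -- in that of `χ_{(-∞,s]}(a)`, which is orthogonal to that of `χ_{(s,∞)}(a)`.
    have he := (isStarProjection_spectralProjection b.1 (Iic s)).one_sub
    have hmem : (⟨_, sub_mem (one_mem _) (x.1.spectralProjection_mem b.2.1 (Iic s)), he⟩ :
        x.1.Proj) ∈ projAbove (spectralProjection a (Ioi s)) x.1 := by
      refine (spectralProjection_le_iff he).2 fun w hw => ?_
      rw [sub_apply, one_apply_eq_self, sub_eq_self, spectralProjection_apply_eq_zero_iff,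
        Submodule.mem_orthogonal]
      exact fun u hu => inner_eq_zero_of_disjoint ha (Iic_disjoint_Ioi le_rfl)
        (spectralLE_iff.1 hb s hu) hw
    have := apply_eq_self_of_le q.2.2 he ((isGLB_outerDasProj _ x.1).1 hmem) hv
    rwa [sub_apply, one_apply_eq_self, sub_eq_self, spectralProjection_apply_eq_zero_iff] at this
  have h2 := pairing_mono x.2 hle
  rwa [pairing_twoValued, h1, Complex.one_re, mul_one, sub_self, mul_zero, add_zero] at h2

end Daseinisation

end ContravariantModel

end

theorem theorem3p16 {H : Type*} [NormedAddCommGroup H] [InnerProductSpace ℂ H] [CompleteSpace H]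
    (A : VonNeumannAlgebra H) (a : H →L[ℂ] H) (haA : a ∈ A) (ha : IsSelfAdjoint a) :
    (∀ C : ContravariantModel.Context A,
      IsLUB (ContravariantModel.spectrallyBelow a C) (ContravariantModel.innerDas a C) ∧
      IsGLB (ContravariantModel.spectrallyAbove a C) (ContravariantModel.outerDas a C) ∧
      ∀ Δ : Set ℝ, MeasurableSet Δ →
        IsGLB (ContravariantModel.projAbove (ContravariantModel.spectralProjection a Δ) C)
          (ContravariantModel.outerDasProj (ContravariantModel.spectralProjection a Δ) C)) ∧
    Continuous (ContravariantModel.das A a) ∧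
    ∀ r s ε : ℝ, 0 < ε →
      ContravariantModel.das A a ⁻¹' (ContravariantModel.hatOpen A r s) ⊆
        ContravariantModel.elementaryProp A a (Set.Iio r) ∩
          ContravariantModel.elementaryProp A a (Set.Ioi s) ∧
      ContravariantModel.elementaryProp A a (Set.Iio r) ∩
          ContravariantModel.elementaryProp A a (Set.Ioi s) ⊆
        ContravariantModel.das A a ⁻¹' (ContravariantModel.hatOpenAdd A r s ε) := by
  refine ⟨fun C => ⟨ContravariantModel.isLUB_innerDas ha C, ContravariantModel.isGLB_outerDas ha C,
    fun Δ _ => ContravariantModel.isGLB_outerDasProj _ C⟩, ContravariantModel.continuous_das ha,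
    fun r s ε hε => ⟨fun x hx => ⟨?_, ?_⟩, fun x hx => ⟨trivial, ?_, ?_⟩⟩⟩
  · exact ContravariantModel.mem_elementaryProp_Iio_of_pairing_lt ha (EReal.coe_lt_coe_iff.1 hx.2.1)
  · exact ContravariantModel.mem_elementaryProp_Ioi_of_lt_pairing ha (EReal.coe_lt_coe_iff.1 hx.2.2)
  · refine EReal.coe_lt_coe_iff.2 (lt_of_le_of_lt ?_ (lt_add_of_pos_right r hε))
    exact ContravariantModel.pairing_innerDas_le_of_mem ha hx.1
  · refine EReal.coe_lt_coe_iff.2 (lt_of_lt_of_le (sub_lt_self s hε) ?_)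
    exact ContravariantModel.le_pairing_outerDas_of_mem ha hx.2
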